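/- Let $(s(n))_{n\ge 0}$ be Stern's diatomic sequence, defined by $s(0)=0$, $s(1)=1$ and, for $n\ge 0$, $s(2n)=s(n)$, $s(2n+1)=s(n)+s(n+1)$, and let $S(z)=\sum_{n\ge 0}s(n)z^n\in\mathbb{C}[[z]]$ be its generating function (Stern's function). Then $zS(z)-(1+z+z^2)S(z^2)=0$. There is exactly one nonzero power series $F(z)\in\mathbb{C}[[z]]$ all of whose coefficients lie in $\{0,1\}$ and which satisfies $$F(z)-(1+z+z^2)F(z^4)+z^4F(z^{16})=0$$ (the 0-1 Dilcher--Stolarsky function). The functions $S(z)$ and $F(z)$, regarded as elements of the field of formal Laurent series $\mathbb{C}((z))$, are algebraically independent over $\mathbb{C}(z)$; equivalently, $$\operatorname{trdeg}_{\mathbb{C}(z)}\mathbb{C}(z)(S(z),F(z))=2.$$ -/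

import Mathlib

open PowerSeries LaurentSeries

/-- The field `ℂ((z))` of formal Laurent series as an extension of the field `ℂ(z)` of rational
functions: rational functions are expanded in powers of `z`. (This is Mathlib's embedding, which
is only a scoped instance there.) -/
noncomputable instance ratFuncAlgebraLaurentSeries : Algebra (RatFunc ℂ) ℂ⸨X⸩ :=
  RatFunc.liftAlgebra (R := ℂ) (L := ℂ⸨X⸩)

instance isScalarTower_ratFunc_laurentSeries :
    IsScalarTower (Polynomial ℂ) (RatFunc ℂ) ℂ⸨X⸩ :=
  RatFunc.isScalarTower_liftAlgebra (R := ℂ) (L := ℂ⸨X⸩)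

/-- Stern's diatomic sequence: `s 0 = 0`, `s 1 = 1`, `s (2 n) = s n`,
`s (2 n + 1) = s n + s (n + 1)` (see `stern_two_mul` and `stern_two_mul_add_one`). -/
def stern : ℕ → ℕ
  | 0 => 0
  | 1 => 1
  | n + 2 =>
    if n % 2 = 0 then stern (n / 2 + 1) else stern (n / 2 + 1) + stern (n / 2 + 2)
  termination_by n => n
  decreasing_by all_goals omega

theorem stern_zero : stern 0 = 0 := by
  simp [stern]

theorem stern_one : stern 1 = 1 := by
  simp [stern]

theorem stern_two_mul (n : ℕ) : stern (2 * n) = stern n := by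
  rcases n with _ | n
  · rfl
  · rw [show 2 * (n + 1) = 2 * n + 2 by ring, stern]
    simp

theorem stern_two_mul_add_one (n : ℕ) :
    stern (2 * n + 1) = stern n + stern (n + 1) := by
  rcases n with _ | n
  · simp [stern]
  · rw [show 2 * (n + 1) + 1 = (2 * n + 1) + 2 by ring, stern, if_neg (by omega)]
    rw [show (2 * n + 1) / 2 = n by omega]

/-- Stern's function `S(z) = ∑ s(n) zⁿ`, as a formal power series over `ℂ`. -/
noncomputable def sternSeries : ℂ⟦X⟧ :=
  PowerSeries.mk fun n => (stern n : ℂ)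

/-- `F` is a 0-1 Dilcher–Stolarsky function: a nonzero power series with coefficients in `{0, 1}`
satisfying `F(z) - (1 + z + z²) F(z⁴) + z⁴ F(z¹⁶) = 0`. Here `PowerSeries.expand m` is the
substitution `z ↦ zᵐ`. -/
def IsDilcherStolarsky (F : ℂ⟦X⟧) : Prop :=
  F ≠ 0 ∧ (∀ n : ℕ, coeff n F = 0 ∨ coeff n F = 1) ∧
    F - (1 + X + X ^ 2) * expand 4 (by norm_num) F + X ^ 4 * expand 16 (by norm_num) F = 0

/-! ### The functional equations on coefficients -/

/-! Algebraic independence comes from growth rates as `x → 1⁻` along points `x_n` with `x_{n+1}⁴ =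
x_n`. From one point to the next, `S` is multiplied asymptotically by `9` (Stern's equation applied
twice, `1 + z + z²` tending to `3` each time), a nonzero polynomial by `4^{-m}` with `m` its order
of vanishing at `1`, and `F` by `φ²`, the larger fixed point of `r ↦ 3 - 1/r`.

Each term `p_{ij} S^i F^j` of a polynomial relation thus has limiting ratio `4^{-m} 9^i φ^{2j}`.
These numbers differ for different `(i, j)`, as positive powers of `φ` are irrational and `9` is
prime to `4`. The term with the largest ratio dominates, so the sum cannot vanish: see
`sum_ne_zero_of_ratio_tendsto` and `IsDilcherStolarsky.aeval_ne_zero`.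

Existence and uniqueness of `F` hold because its equation is a recurrence on coefficients that
leaves only `F(0)` free. -/

theorem coeff_X_pow_mul_expand {R : Type*} [CommRing R] (p : ℕ) (hp : p ≠ 0) (d n : ℕ)
    (hd : d < p) (F : R⟦X⟧) :
    coeff n (X ^ d * expand p hp F) = if n % p = d then coeff (n / p) F else 0 := by
  rw [coeff_X_pow_mul']
  by_cases h : d ≤ n
  · rw [if_pos h, coeff_expand]
    have hiff : p ∣ n - d ↔ n % p = d := by
      rw [← Nat.modEq_iff_dvd' h]
      unfold Nat.ModEq
      rw [Nat.mod_eq_of_lt hd, eq_comm]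
    by_cases h' : n % p = d
    · rw [if_pos (hiff.2 h'), if_pos h']
      congr 1
      have := Nat.div_add_mod n p
      rw [h'] at this
      conv_lhs => rw [← this, Nat.add_sub_cancel, Nat.mul_div_cancel_left _ (Nat.pos_of_ne_zero hp)]
    · rw [if_neg (fun h'' => h' (hiff.1 h'')), if_neg h']
  · rw [if_neg h, if_neg]
    intro h'
    exact h (h' ▸ Nat.mod_le n p)

theorem sternSeries_functional_equation :
    X * sternSeries - (1 + X + X ^ 2) * expand 2 (by norm_num) sternSeries = 0 := by
  rw [sub_eq_zero]
  ext n
  have h0 := coeff_X_pow_mul_expand 2 (by norm_num) 0 n (by norm_num) sternSeries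
  have h1 := coeff_X_pow_mul_expand 2 (by norm_num) 1 n (by norm_num) sternSeries
  -- The exponent `2` is not below the modulus `2`, so `X ^ 2` is handled by a shift; truncation of
  -- `n - 2` is harmless because of the guard `2 ≤ n` in `coeff_X_pow_mul'`.
  have h2 := coeff_X_pow_mul_expand 2 (by norm_num) 0 (n - 2) (by norm_num) sternSeries
  rw [pow_zero, one_mul] at h0 h2
  rw [pow_one] at h1
  rw [add_mul, add_mul, one_mul, map_add, map_add, h0, h1, coeff_X_pow_mul', h2]
  simp only [sternSeries, coeff_mk]
  rcases n with _ | n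
  · simp [stern_zero]
  rw [coeff_succ_X_mul, coeff_mk]
  obtain ⟨k, rfl | rfl⟩ := n.even_or_odd'
  · rw [stern_two_mul, if_neg (by omega), if_pos (by omega), show (2 * k + 1) / 2 = k by omega]
    split_ifs <;> first | omega | simp
  · rw [stern_two_mul_add_one, if_pos (by omega), if_neg (by omega), if_pos (by omega),
      if_pos (by omega), show (2 * k + 1 + 1) / 2 = k + 1 by omega,
      show (2 * k + 1 + 1 - 2) / 2 = k by omega]
    push_cast
    ring

/-- The factors `1`, `z`, `z²` serve the residues `0`, `1`, `2` mod `4`, and no term serves `3`. At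
`n = 0` the recurrence is a tautology. -/
theorem dilcherStolarsky_equation_iff (F : ℂ⟦X⟧) :
    F - (1 + X + X ^ 2) * expand 4 (by norm_num) F + X ^ 4 * expand 16 (by norm_num) F = 0 ↔
      ∀ n, coeff n F =
        (if n % 4 = 3 then 0 else coeff (n / 4) F) - if n % 16 = 4 then coeff (n / 16) F else 0 := by
  rw [PowerSeries.ext_iff]
  refine forall_congr' fun n => ?_
  have h0 := coeff_X_pow_mul_expand 4 (by norm_num) 0 n (by norm_num) F
  have h1 := coeff_X_pow_mul_expand 4 (by norm_num) 1 n (by norm_num) F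
  have h2 := coeff_X_pow_mul_expand 4 (by norm_num) 2 n (by norm_num) F
  have h4 := coeff_X_pow_mul_expand 16 (by norm_num) 4 n (by norm_num) F
  rw [pow_zero, one_mul] at h0
  rw [pow_one] at h1
  rw [add_mul, add_mul, one_mul, map_add, map_sub, map_add, map_add, h0, h1, h2, h4, map_zero]
  have hn : n % 4 = 0 ∨ n % 4 = 1 ∨ n % 4 = 2 ∨ n % 4 = 3 := by omega
  rcases hn with h | h | h | h <;> simp only [h] <;> norm_num <;>
    constructor <;> intro h' <;> linear_combination h'

/-- The coefficients of the 0-1 Dilcher–Stolarsky function. -/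
def dilcherStolarskyCoeff (n : ℕ) : ℕ :=
  if n = 0 then 1
  else if n % 4 = 3 ∨ n % 16 = 4 then 0
  else dilcherStolarskyCoeff (n / 4)
  termination_by n
  decreasing_by omega

theorem dilcherStolarskyCoeff_eq (n : ℕ) :
    dilcherStolarskyCoeff n =
      if n % 4 = 3 ∨ n % 16 = 4 then 0 else dilcherStolarskyCoeff (n / 4) := by
  rcases Nat.eq_zero_or_pos n with rfl | h
  · simp
  · rw [dilcherStolarskyCoeff, if_neg h.ne']

theorem dilcherStolarskyCoeff_zero_or_one (n : ℕ) :
    dilcherStolarskyCoeff n = 0 ∨ dilcherStolarskyCoeff n = 1 := by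
  induction n using Nat.strong_induction_on with
  | _ n ih =>
    rcases Nat.eq_zero_or_pos n with rfl | h
    · right
      rw [dilcherStolarskyCoeff, if_pos rfl]
    · rw [dilcherStolarskyCoeff_eq]
      split_ifs
      · exact Or.inl rfl
      · exact ih _ (by omega)

theorem isDilcherStolarsky_mk :
    IsDilcherStolarsky (PowerSeries.mk fun n => (dilcherStolarskyCoeff n : ℂ)) := by
  refine ⟨fun h => ?_, fun n => ?_, ?_⟩
  · have := congrArg (coeff 0) h
    rw [coeff_mk, dilcherStolarskyCoeff, if_pos rfl] at this
    simp at this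
  · rw [coeff_mk]
    rcases dilcherStolarskyCoeff_zero_or_one n with h | h <;> simp [h]
  · rw [dilcherStolarsky_equation_iff]
    intro n
    simp only [coeff_mk]
    rw [dilcherStolarskyCoeff_eq n]
    by_cases h3 : n % 4 = 3
    · simp [h3, show n % 16 ≠ 4 by omega]
    by_cases h4 : n % 16 = 4
    -- Here `n / 4` is `1` mod `4`, so its coefficient equals that at `n / 16` and the two terms
    -- cancel.
    · rw [dilcherStolarskyCoeff_eq (n / 4), if_pos (Or.inr h4), if_neg h3, if_pos h4,
        if_neg (by omega), show n / 4 / 4 = n / 16 by omega]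
      simp
    · simp [h3, h4]

/-- For `n > 0` the recurrence only involves smaller indices. Only the recurrence is asked of `G`,
so that `G = 0` is allowed; this gives `F(0) ≠ 0`. -/
theorem IsDilcherStolarsky.ext_of_coeff_zero {F G : ℂ⟦X⟧} (hF : IsDilcherStolarsky F)
    (hG : ∀ n, coeff n G =
        (if n % 4 = 3 then 0 else coeff (n / 4) G) - if n % 16 = 4 then coeff (n / 16) G else 0)
    (h : coeff 0 F = coeff 0 G) : F = G := by
  have hF' := (dilcherStolarsky_equation_iff F).1 hF.2.2
  ext n
  induction n using Nat.strong_induction_on with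
  | _ n ih =>
    rcases Nat.eq_zero_or_pos n with rfl | hn
    · exact h
    · rw [hF', hG, ih (n / 4) (by omega), ih (n / 16) (by omega)]

theorem IsDilcherStolarsky.coeff_zero {F : ℂ⟦X⟧} (hF : IsDilcherStolarsky F) :
    coeff 0 F = 1 := by
  refine (hF.2.1 0).resolve_left fun h => hF.1 ?_
  exact hF.ext_of_coeff_zero (G := 0) (by simp) (by simpa using h)

theorem existsUnique_isDilcherStolarsky : ∃! F : ℂ⟦X⟧, IsDilcherStolarsky F :=
  ⟨_, isDilcherStolarsky_mk, fun _ hF => hF.ext_of_coeff_zero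
    ((dilcherStolarsky_equation_iff _).1 isDilcherStolarsky_mk.2.2)
    (hF.coeff_zero.trans isDilcherStolarsky_mk.coeff_zero.symm)⟩

/-! ### Values of absolutely convergent power series -/

/-- The power series `F` converges absolutely at `x`, with sum `v`. -/
def ConvergesTo (x : ℂ) (F : ℂ⟦X⟧) (v : ℂ) : Prop :=
  (Summable fun n => ‖coeff n F * x ^ n‖) ∧ HasSum (fun n => coeff n F * x ^ n) v

namespace ConvergesTo

variable {x : ℂ} {F G : ℂ⟦X⟧} {v w : ℂ}

theorem unique (hF : ConvergesTo x F v) (hF' : ConvergesTo x F w) : v = w :=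
  HasSum.unique hF.2 hF'.2

theorem add (hF : ConvergesTo x F v) (hG : ConvergesTo x G w) : ConvergesTo x (F + G) (v + w) := by
  constructor
  · refine (hF.1.add hG.1).of_nonneg_of_le (fun _ => norm_nonneg _) fun n => ?_
    rw [map_add, add_mul]
    exact norm_add_le _ _
  · simpa only [map_add, add_mul] using HasSum.add hF.2 hG.2

/-- Absolute convergence is what makes the Cauchy product converge to the product of the sums. -/
theorem mul (hF : ConvergesTo x F v) (hG : ConvergesTo x G w) : ConvergesTo x (F * G) (v * w) := by
  have key : (fun n => coeff n (F * G) * x ^ n) = fun n =>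
      ∑ kl ∈ Finset.HasAntidiagonal.antidiagonal n, (coeff kl.1 F * x ^ kl.1) * (coeff kl.2 G * x ^ kl.2) := by
    funext n
    rw [coeff_mul, Finset.sum_mul]
    refine Finset.sum_congr rfl fun kl hkl => ?_
    rw [← Finset.HasAntidiagonal.mem_antidiagonal.1 hkl, pow_add]
    ring
  have hs := summable_norm_sum_mul_antidiagonal_of_summable_norm hF.1 hG.1
  have ht := tsum_mul_tsum_eq_tsum_sum_antidiagonal_of_summable_norm hF.1 hG.1
  rw [hF.2.tsum_eq, hG.2.tsum_eq] at ht
  unfold ConvergesTo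
  rw [key]
  refine ⟨?_, ht ▸ hs.of_norm.hasSum⟩
  rw [show (fun n => ‖coeff n (F * G) * x ^ n‖) = _ from funext fun n =>
    congrArg norm (congrFun key n)]
  exact hs

theorem monomial (x : ℂ) (k : ℕ) (a : ℂ) :
    ConvergesTo x (PowerSeries.monomial k a) (a * x ^ k) := by
  have h : ∀ n, n ≠ k → coeff n (PowerSeries.monomial k a) * x ^ n = 0 := fun n hn => by
    rw [coeff_monomial, if_neg hn, zero_mul]
  constructor
  · refine (hasSum_single k fun n hn => ?_).summable
    rw [h n hn, norm_zero]
  · convert hasSum_single k h using 1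
    rw [coeff_monomial, if_pos rfl]

theorem C (x a : ℂ) : ConvergesTo x (PowerSeries.C a) a := by
  simpa [monomial_zero_eq_C_apply] using monomial x 0 a

theorem one (x : ℂ) : ConvergesTo x 1 1 := by
  simpa using C x 1

theorem zero (x : ℂ) : ConvergesTo x 0 0 := by
  simpa using C x 0

theorem X (x : ℂ) : ConvergesTo x PowerSeries.X x := by
  simpa [X_eq] using monomial x 1 1

theorem neg (hF : ConvergesTo x F v) : ConvergesTo x (-F) (-v) := by
  simpa using (C x (-1)).mul hF

theorem sub (hF : ConvergesTo x F v) (hG : ConvergesTo x G w) : ConvergesTo x (F - G) (v - w) := by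
  simpa only [sub_eq_add_neg] using hF.add hG.neg

theorem pow (hF : ConvergesTo x F v) (k : ℕ) : ConvergesTo x (F ^ k) (v ^ k) := by
  induction k with
  | zero => simpa using one x
  | succ k ih => simpa only [pow_succ] using ih.mul hF

theorem sum {ι : Type*} (s : Finset ι) {F : ι → ℂ⟦X⟧} {v : ι → ℂ}
    (h : ∀ i ∈ s, ConvergesTo x (F i) (v i)) : ConvergesTo x (∑ i ∈ s, F i) (∑ i ∈ s, v i) := by
  classical
  induction s using Finset.induction_on with
  | empty => simpa using zero x
  | insert i s hi ih =>
    rw [Finset.sum_insert hi, Finset.sum_insert hi]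
    exact (h i (Finset.mem_insert_self i s)).add
      (ih fun j hj => h j (Finset.mem_insert_of_mem hj))

theorem coe_polynomial (x : ℂ) (p : Polynomial ℂ) : ConvergesTo x (p : ℂ⟦X⟧) (p.eval x) := by
  induction p using Polynomial.induction_on' with
  | add p q hp hq => simpa using hp.add hq
  | monomial n a => simpa using monomial x n a

theorem expand (p : ℕ) (hp : p ≠ 0) (hF : ConvergesTo (x ^ p) F v) :
    ConvergesTo x (PowerSeries.expand p hp F) v := by
  have hinj : Function.Injective fun n : ℕ => p * n :=
    fun a b h => Nat.eq_of_mul_eq_mul_left (Nat.pos_of_ne_zero hp) h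
  have h0 : ∀ n ∉ Set.range fun n : ℕ => p * n,
      coeff n (PowerSeries.expand p hp F) * x ^ n = 0 := fun n hn => by
    rw [coeff_expand_of_not_dvd, zero_mul]
    rintro ⟨k, rfl⟩
    exact hn ⟨k, rfl⟩
  have hcomp : ∀ n, coeff (p * n) (PowerSeries.expand p hp F) * x ^ (p * n) =
      coeff n F * (x ^ p) ^ n := fun n => by
    rw [coeff_expand_mul, pow_mul]
  constructor
  · rw [← hinj.summable_iff fun n hn => by rw [h0 n hn, norm_zero]]
    simpa only [Function.comp_def, hcomp] using hF.1
  · rw [← hinj.hasSum_iff h0]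
    simpa only [Function.comp_def, hcomp] using hF.2

theorem ofReal {a : ℕ → ℝ} (ha : ∀ n, 0 ≤ a n) {x : ℝ} (hx : 0 ≤ x)
    (h : Summable fun n => a n * x ^ n) :
    ConvergesTo x (PowerSeries.mk fun n => (a n : ℂ)) (∑' n, a n * x ^ n : ℝ) := by
  have key : ∀ n, coeff n (PowerSeries.mk fun n => (a n : ℂ)) * (x : ℂ) ^ n =
      (a n * x ^ n : ℝ) := fun n => by
    rw [coeff_mk]
    push_cast
    rfl
  unfold ConvergesTo
  simp only [key]
  refine ⟨?_, Complex.hasSum_ofReal.2 h.hasSum⟩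
  simpa only [Complex.norm_real, Real.norm_of_nonneg (mul_nonneg (ha _) (pow_nonneg hx _))] using h

end ConvergesTo

/-! ### Ratios along sequences -/

open Filter Topology in
theorem tendsto_zero_of_le_half_mul_add {e δ : ℕ → ℝ} (he : ∀ n, 0 ≤ e n)
    (hδ : Tendsto δ atTop (𝓝 0)) (h : ∀ n, e (n + 1) ≤ δ n + e n / 2) :
    Tendsto e atTop (𝓝 0) := by
  rw [Metric.tendsto_atTop]
  intro ε hε
  obtain ⟨N, hN⟩ := eventually_atTop.1 (hδ.eventually (gt_mem_nhds (show 0 < ε / 4 by positivity)))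
  -- `ε / 2` is the fixed point of `t ↦ ε / 4 + t / 2`.
  have key : ∀ k, e (N + k) ≤ ε / 2 + e N * (1 / 2) ^ k := by
    intro k
    induction k with
    | zero => simpa using by linarith [he N]
    | succ k ih =>
      have h1 := h (N + k)
      have h2 := hN (N + k) (by omega)
      rw [pow_succ, ← add_assoc]
      linarith
  have hlim : Tendsto (fun k : ℕ => e N * (1 / 2 : ℝ) ^ k) atTop (𝓝 0) := by
    simpa using (tendsto_pow_atTop_nhds_zero_of_lt_one (r := (1 / 2 : ℝ))
      (by norm_num) (by norm_num)).const_mul (e N)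
  obtain ⟨K, hK⟩ := eventually_atTop.1
    (hlim.eventually (gt_mem_nhds (show 0 < ε / 2 by positivity)))
  refine ⟨N + K, fun n hn => ?_⟩
  obtain ⟨k, rfl⟩ := Nat.exists_eq_add_of_le (show N ≤ n by omega)
  rw [Real.dist_eq, sub_zero, abs_of_nonneg (he _)]
  linarith [key k, hK k (by omega)]

open Filter Topology Real in
-- The limiting map `r ↦ 3 - 1/r` fixes `φ²` and `φ⁻²`. The bound `1 ≤ r n` excludes the repelling
-- point `φ⁻² < 1` and, since `φ² ≥ 2`, makes the map contract distances to `φ²` by at least one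
-- half.
theorem tendsto_goldenRatio_sq_of_recurrence {r A B : ℕ → ℝ}
    (hA : Tendsto A atTop (𝓝 3)) (hB : Tendsto B atTop (𝓝 1)) (hr : ∀ n, 1 ≤ r n)
    (h : ∀ n, r (n + 1) = A n - B n / r n) :
    Tendsto r atTop (𝓝 (goldenRatio ^ 2)) := by
  have hφ2 : 2 ≤ goldenRatio ^ 2 := by
    rw [goldenRatio_sq]
    linarith [one_lt_goldenRatio]
  have hfix : goldenRatio ^ 2 = 3 - 1 / goldenRatio ^ 2 := by
    have h0 : goldenRatio ^ 2 ≠ 0 := by positivity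
    rw [eq_sub_iff_add_eq, ← mul_left_inj' h0, add_mul, one_div, inv_mul_cancel₀ h0]
    linear_combination (goldenRatio ^ 2 + goldenRatio - 1) * goldenRatio_sq
  have hδ : Tendsto (fun n => |A n - 3| + |B n - 1|) atTop (𝓝 0) := by
    have h1 := (hA.sub_const 3).abs
    have h2 := (hB.sub_const 1).abs
    simpa using h1.add h2
  refine tendsto_iff_norm_sub_tendsto_zero.2
    (tendsto_zero_of_le_half_mul_add (fun _ => norm_nonneg _) hδ fun n => ?_)
  set ρ := goldenRatio ^ 2 with hρ
  have hrn := hr n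
  have heq : r (n + 1) - ρ = (A n - 3) - (B n - 1) / r n + (r n - ρ) / (r n * ρ) := by
    rw [h, show (r n - ρ) / (r n * ρ) = 1 / ρ - 1 / r n by field_simp]
    linear_combination -hfix
  have e1 : |(B n - 1) / r n| ≤ |B n - 1| := by
    rw [abs_div, abs_of_nonneg (by linarith : 0 ≤ r n)]
    exact div_le_self (abs_nonneg _) hrn
  have e2 : |(r n - ρ) / (r n * ρ)| ≤ |r n - ρ| / 2 := by
    have h2 : 2 ≤ r n * ρ := by nlinarith
    rw [abs_div, abs_of_nonneg (by linarith : 0 ≤ r n * ρ)]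
    exact div_le_div_of_nonneg_left (abs_nonneg _) (by norm_num) h2
  rw [heq, Real.norm_eq_abs, Real.norm_eq_abs]
  have t1 := abs_add_le ((A n - 3) - (B n - 1) / r n) ((r n - ρ) / (r n * ρ))
  have t2 := abs_sub (A n - 3) ((B n - 1) / r n)
  linarith

open Filter Topology in
/-- Sequences whose ratios of consecutive terms tend to distinct positive limits do not add up
to zero. -/
theorem sum_ne_zero_of_ratio_tendsto {ι : Type*} {s : Finset ι} (hs : s.Nonempty)
    {t : ι → ℕ → ℂ} {l : ι → ℝ} (hl : ∀ i ∈ s, 0 < l i) (hinj : Set.InjOn l s)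
    (ht : ∀ i ∈ s, ∀ᶠ n in atTop, t i n ≠ 0)
    (hlim : ∀ i ∈ s, Tendsto (fun n => ‖t i (n + 1)‖ / ‖t i n‖) atTop (𝓝 (l i))) :
    ∃ n, ∑ i ∈ s, t i n ≠ 0 := by
  classical
  by_contra! h0
  obtain ⟨m, hm, hmax⟩ := s.exists_max_image l hs
  have hsmall : ∀ i ∈ s.erase m, Tendsto (fun n => t i n / t m n) atTop (𝓝 0) := by
    intro i hi
    obtain ⟨him, his⟩ := Finset.mem_erase.1 hi
    have hlt : l i < l m := lt_of_le_of_ne (hmax i his) fun h => him (hinj his hm h)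
    -- The quotients have limiting ratio `l i / l m < 1`, so the ratio test makes them summable,
    -- hence null.
    refine Summable.tendsto_atTop_zero (summable_of_ratio_test_tendsto_lt_one
      ((div_lt_one (hl m hm)).2 hlt) ?_ ?_)
    · filter_upwards [ht i his, ht m hm] with n h1 h2 using div_ne_zero h1 h2
    · refine ((hlim i his).div (hlim m hm) (hl m hm).ne').congr fun n => ?_
      rw [norm_div, norm_div, div_div_div_comm, Pi.div_apply]
  have hsum := tendsto_finsetSum (s.erase m) hsmall
  rw [Finset.sum_const_zero] at hsum
  have hone : (fun n => ∑ i ∈ s.erase m, t i n / t m n) =ᶠ[atTop] fun _ => -1 := by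
    filter_upwards [ht m hm] with n hn
    have := h0 n
    rw [← Finset.add_sum_erase s _ hm] at this
    rw [← Finset.sum_div, div_eq_iff hn]
    linear_combination this
  have := tendsto_nhds_unique (hsum.congr' hone) tendsto_const_nhds
  norm_num at this

open Real in
theorem goldenRatio_pow_irrational {n : ℕ} (hn : n ≠ 0) : Irrational (goldenRatio ^ n) := by
  obtain ⟨k, rfl⟩ := Nat.exists_eq_succ_of_ne_zero hn
  rw [Nat.succ_eq_add_one, ← goldenRatio_mul_fib_succ_add_fib]
  exact (goldenRatio_irrational.mul_natCast (Nat.fib_pos.2 k.succ_pos).ne').add_natCast _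

open Real in
-- Irrationality of positive powers of `φ` forces `j = j'`; comparing powers of `3` then gives `i =
-- i'`.
theorem four_pow_mul_nine_pow_mul_goldenRatio_pow_injective {m m' i i' j j' : ℕ}
    (h : (1 / 4 : ℝ) ^ m * (9 ^ i * (goldenRatio ^ 2) ^ j) =
      (1 / 4) ^ m' * (9 ^ i' * (goldenRatio ^ 2) ^ j')) : i = i' ∧ j = j' := by
  wlog hj : j ≤ j' generalizing m m' i i' j j'
  · exact (this h.symm (le_of_not_ge hj)).imp Eq.symm Eq.symm
  obtain ⟨k, rfl⟩ := Nat.exists_eq_add_of_le hj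
  have hφ : (goldenRatio ^ 2) ^ j ≠ 0 := by positivity
  have h1 : (4 : ℝ) ^ m' * 9 ^ i = 4 ^ m * 9 ^ i' * goldenRatio ^ (2 * k) := by
    rw [pow_add, ← pow_mul _ 2 k, one_div, inv_pow, inv_pow] at h
    field_simp at h
    linear_combination h
  rcases Nat.eq_zero_or_pos k with rfl | hk
  · refine ⟨?_, rfl⟩
    rw [mul_zero, pow_zero, mul_one] at h1
    have h2 : 4 ^ m' * 9 ^ i = 4 ^ m * 9 ^ i' := by exact_mod_cast h1
    have key : ∀ a b : ℕ, (4 ^ a * 9 ^ b).factorization 3 = 2 * b := fun a b => by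
      rw [Nat.factorization_mul (by positivity) (by positivity), show 4 = 2 ^ 2 by norm_num,
        show 9 = 3 ^ 2 by norm_num, ← pow_mul, ← pow_mul,
        Nat.Prime.factorization_pow Nat.prime_two, Nat.Prime.factorization_pow Nat.prime_three]
      simp
    have := key m' i
    rw [h2, key] at this
    omega
  · exfalso
    refine goldenRatio_pow_irrational (n := 2 * k) (by omega) ⟨4 ^ m' * 9 ^ i / (4 ^ m * 9 ^ i'), ?_⟩
    push_cast
    rw [h1]
    field_simp

/-! ### Radial behaviour at `z = 1` -/

/-- A sequence in `(0, 1)` tending to `1`, each term being the fourth power of the next one. -/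
noncomputable def radialPoint (n : ℕ) : ℝ := Real.exp (-(1 / 4) ^ n)

theorem radialPoint_pos (n : ℕ) : 0 < radialPoint n := Real.exp_pos _

theorem radialPoint_lt_one (n : ℕ) : radialPoint n < 1 :=
  Real.exp_lt_one_iff.2 (by simp)

theorem radialPoint_succ_pow_four (n : ℕ) : radialPoint (n + 1) ^ 4 = radialPoint n := by
  rw [radialPoint, radialPoint, ← Real.exp_nat_mul]
  congr 1
  push_cast
  ring

open Filter Topology in
theorem tendsto_radialPoint : Tendsto radialPoint atTop (𝓝 1) := by
  have h : Tendsto (fun n : ℕ => -(1 / 4 : ℝ) ^ n) atTop (𝓝 (-0)) :=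
    (tendsto_pow_atTop_nhds_zero_of_lt_one (by norm_num) (by norm_num)).neg
  rw [← Real.exp_zero, ← neg_zero]
  exact (Real.continuous_exp.tendsto _).comp h

open Filter Topology in
-- Write `p = (z - 1)^m q` with `q(1) ≠ 0`. For `x = x_{n+1}`, `x⁴ - 1 = (1 + x + x² + x³)(x - 1)`,
-- and the first factor tends to `4`.
theorem tendsto_ratio_eval_radialPoint {p : Polynomial ℂ} (hp : p ≠ 0) :
    (∀ᶠ n in atTop, p.eval (radialPoint n : ℂ) ≠ 0) ∧
    Tendsto (fun n => ‖p.eval (radialPoint (n + 1) : ℂ)‖ / ‖p.eval (radialPoint n : ℂ)‖) atTop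
      (𝓝 ((1 / 4) ^ p.rootMultiplicity 1)) := by
  obtain ⟨q, hpq, hq⟩ := p.exists_eq_pow_rootMultiplicity_mul_and_not_dvd hp 1
  rw [Polynomial.dvd_iff_isRoot, Polynomial.IsRoot.def] at hq
  set m := p.rootMultiplicity 1
  have hx : Tendsto (fun n => (radialPoint n : ℂ)) atTop (𝓝 1) := by
    rw [← Complex.ofReal_one]
    exact (Complex.continuous_ofReal.tendsto 1).comp tendsto_radialPoint
  have hqx : Tendsto (fun n => q.eval (radialPoint n : ℂ)) atTop (𝓝 (q.eval 1)) :=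
    (q.continuous.tendsto 1).comp hx
  have hqne : ∀ᶠ n in atTop, q.eval (radialPoint n : ℂ) ≠ 0 :=
    hqx.eventually_ne hq
  have hne : ∀ n, (radialPoint n : ℂ) - 1 ≠ 0 := fun n h => by
    have : (radialPoint n : ℂ) = (1 : ℝ) := by simpa [sub_eq_zero] using h
    exact (radialPoint_lt_one n).ne (Complex.ofReal_injective this)
  have heval : ∀ n, p.eval (radialPoint n : ℂ) =
      ((radialPoint n : ℂ) - 1) ^ m * q.eval (radialPoint n : ℂ) := fun n => by
    conv_lhs => rw [hpq]
    simp
  have hlin : Tendsto (fun n => ‖(radialPoint (n + 1) : ℂ) - 1‖ / ‖(radialPoint n : ℂ) - 1‖) atTop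
      (𝓝 (1 / 4)) := by
    have hx1 := hx.comp (tendsto_add_atTop_nat 1)
    have h4 : Tendsto (fun n => ‖1 + (radialPoint (n + 1) : ℂ) + (radialPoint (n + 1) : ℂ) ^ 2 +
        (radialPoint (n + 1) : ℂ) ^ 3‖⁻¹) atTop (𝓝 ‖(1 : ℂ) + 1 + 1 ^ 2 + 1 ^ 3‖⁻¹) :=
      ((((hx1.const_add 1).add (hx1.pow 2)).add (hx1.pow 3)).norm).inv₀ (by norm_num)
    rw [show ‖(1 : ℂ) + 1 + 1 ^ 2 + 1 ^ 3‖⁻¹ = 1 / 4 by norm_num] at h4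
    refine h4.congr fun n => ?_
    have hfac : (radialPoint n : ℂ) - 1 = (1 + (radialPoint (n + 1) : ℂ) +
        (radialPoint (n + 1) : ℂ) ^ 2 + (radialPoint (n + 1) : ℂ) ^ 3) *
        ((radialPoint (n + 1) : ℂ) - 1) := by
      rw [← radialPoint_succ_pow_four n]
      push_cast
      ring
    rw [hfac, norm_mul, ← div_div, div_right_comm, div_self (norm_ne_zero_iff.2 (hne _)), one_div]
  refine ⟨?_, ?_⟩
  · filter_upwards [hqne] with n hn
    rw [heval]
    exact mul_ne_zero (pow_ne_zero _ (hne n)) hn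
  · have hqr : Tendsto (fun n => ‖q.eval (radialPoint (n + 1) : ℂ)‖ /
        ‖q.eval (radialPoint n : ℂ)‖) atTop (𝓝 1) := by
      have h1 : Tendsto (fun n => ‖q.eval (radialPoint (n + 1) : ℂ)‖) atTop (𝓝 ‖q.eval 1‖) :=
        (hqx.comp (tendsto_add_atTop_nat 1)).norm
      have h2 := h1.div hqx.norm (norm_ne_zero_iff.2 hq)
      rwa [div_self (norm_ne_zero_iff.2 hq)] at h2
    have h3 := (hlin.pow m).mul hqr
    rw [mul_one] at h3
    refine h3.congr fun n => ?_
    rw [heval, heval, norm_mul, norm_mul, norm_pow, norm_pow, div_pow, div_mul_div_comm]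

/-! ### Growth of Stern's function along the radius -/

theorem stern_le (n : ℕ) : stern n ≤ n := by
  induction n using Nat.strong_induction_on with
  | _ n ih =>
    obtain ⟨k, rfl | rfl⟩ := n.even_or_odd'
    · rcases Nat.eq_zero_or_pos k with rfl | hk
      · simp [stern_zero]
      · rw [stern_two_mul]
        exact (ih k (by omega)).trans (by omega)
    · rcases Nat.eq_zero_or_pos k with rfl | hk
      · simp [stern_one]
      · rw [stern_two_mul_add_one]
        have h1 := ih k (by omega)
        have h2 := ih (k + 1) (by omega)
        omega

/-- The value of Stern's function at a real number. -/
noncomputable def sternValue (x : ℝ) : ℝ := ∑' n, (stern n : ℝ) * x ^ n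

theorem summable_stern {x : ℝ} (h0 : 0 ≤ x) (h1 : x < 1) :
    Summable fun n => (stern n : ℝ) * x ^ n := by
  have h := summable_pow_mul_geometric_of_norm_lt_one 1
    (show ‖x‖ < 1 by rwa [Real.norm_of_nonneg h0])
  refine h.of_nonneg_of_le (fun n => by positivity) fun n => ?_
  rw [pow_one]
  gcongr
  exact_mod_cast stern_le n

theorem convergesTo_sternSeries {x : ℝ} (h0 : 0 ≤ x) (h1 : x < 1) :
    ConvergesTo x sternSeries (sternValue x) := by
  have h := ConvergesTo.ofReal (fun n => Nat.cast_nonneg (stern n)) h0 (summable_stern h0 h1)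
  simp only [Complex.ofReal_natCast] at h
  exact h

theorem sternValue_pos {x : ℝ} (h0 : 0 < x) (h1 : x < 1) : 0 < sternValue x := by
  refine (summable_stern h0.le h1).tsum_pos (fun n => by positivity) 1 ?_
  rw [stern_one]
  simpa using h0

theorem mul_sternValue {x : ℝ} (h0 : 0 ≤ x) (h1 : x < 1) :
    x * sternValue x = (1 + x + x ^ 2) * sternValue (x ^ 2) := by
  have hx := ConvergesTo.X (x : ℂ)
  have h2 := convergesTo_sternSeries (pow_nonneg h0 2) (pow_lt_one₀ h0 h1 two_ne_zero)
  rw [Complex.ofReal_pow] at h2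
  have h := (hx.mul (convergesTo_sternSeries h0 h1)).sub
    ((((ConvergesTo.one _).add hx).add (hx.pow 2)).mul (h2.expand 2 (by norm_num)))
  rw [sternSeries_functional_equation] at h
  have := h.unique (ConvergesTo.zero _)
  rw [sub_eq_zero] at this
  exact_mod_cast this

open Filter Topology in
theorem tendsto_ratio_sternValue : Tendsto
    (fun n => sternValue (radialPoint (n + 1)) / sternValue (radialPoint n)) atTop (𝓝 9) := by
  have hx := tendsto_radialPoint.comp (tendsto_add_atTop_nat 1)
  -- Stern's equation at `x` and at `x²` links `S(x)` to `S(x⁴)`; the denominator is `x · x²`.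
  have h : Tendsto (fun n => (1 + radialPoint (n + 1) + radialPoint (n + 1) ^ 2) *
      (1 + radialPoint (n + 1) ^ 2 + radialPoint (n + 1) ^ 4) / radialPoint (n + 1) ^ 3) atTop
      (𝓝 ((1 + 1 + 1 ^ 2) * (1 + 1 ^ 2 + 1 ^ 4) / 1 ^ 3)) :=
    (((hx.const_add 1).add (hx.pow 2)).mul (((hx.pow 2).const_add 1).add (hx.pow 4))).div
      (hx.pow 3) (by norm_num)
  rw [show (((1 : ℝ) + 1 + 1 ^ 2) * (1 + 1 ^ 2 + 1 ^ 4) / 1 ^ 3) = 9 by norm_num] at h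
  refine h.congr fun n => ?_
  have hpos := radialPoint_pos (n + 1)
  have hlt := radialPoint_lt_one (n + 1)
  have e1 := mul_sternValue hpos.le hlt
  have e2 := mul_sternValue (pow_nonneg hpos.le 2) (pow_lt_one₀ hpos.le hlt two_ne_zero)
  rw [← pow_mul, show 2 * 2 = 4 from rfl, radialPoint_succ_pow_four] at e2
  rw [div_eq_div_iff (by positivity) (sternValue_pos (radialPoint_pos n) (radialPoint_lt_one n)).ne']
  linear_combination (-(1 + radialPoint (n + 1) + radialPoint (n + 1) ^ 2)) * e2 -
    radialPoint (n + 1) ^ 2 * e1 + (1 + radialPoint (n + 1) + radialPoint (n + 1) ^ 2) *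
    sternValue (radialPoint n) * radialPoint_succ_pow_four n

/-! ### Growth of the Dilcher–Stolarsky function along the radius -/

namespace IsDilcherStolarsky

variable {F : ℂ⟦X⟧}

theorem coeff_eq_ofReal (hF : IsDilcherStolarsky F) (n : ℕ) :
    coeff n F = ((coeff n F).re : ℂ) := by
  rcases hF.2.1 n with h | h <;> simp [h]

theorem coeff_re_nonneg (hF : IsDilcherStolarsky F) (n : ℕ) : 0 ≤ (coeff n F).re := by
  rcases hF.2.1 n with h | h <;> simp [h]

theorem coeff_re_le_one (hF : IsDilcherStolarsky F) (n : ℕ) : (coeff n F).re ≤ 1 := by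
  rcases hF.2.1 n with h | h <;> simp [h]

end IsDilcherStolarsky

/-- The sum at a real number of the series of real parts of the terms of `F`. -/
noncomputable def realValue (F : ℂ⟦X⟧) (x : ℝ) : ℝ := ∑' n, (coeff n F).re * x ^ n

namespace IsDilcherStolarsky

variable {F : ℂ⟦X⟧}

theorem summable_coeff_re (hF : IsDilcherStolarsky F) {x : ℝ} (h0 : 0 ≤ x) (h1 : x < 1) :
    Summable fun n => (coeff n F).re * x ^ n :=
  (summable_geometric_of_lt_one h0 h1).of_nonneg_of_le
    (fun n => mul_nonneg (hF.coeff_re_nonneg n) (pow_nonneg h0 n))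
    fun n => mul_le_of_le_one_left (pow_nonneg h0 n) (hF.coeff_re_le_one n)

theorem convergesTo (hF : IsDilcherStolarsky F) {x : ℝ} (h0 : 0 ≤ x) (h1 : x < 1) :
    ConvergesTo x F (realValue F x) := by
  have h := ConvergesTo.ofReal hF.coeff_re_nonneg h0 (hF.summable_coeff_re h0 h1)
  rwa [show (PowerSeries.mk fun n => ((coeff n F).re : ℂ)) = F from
    PowerSeries.ext fun n => by rw [coeff_mk, ← hF.coeff_eq_ofReal]] at h

theorem realValue_pos (hF : IsDilcherStolarsky F) {x : ℝ} (h0 : 0 ≤ x) (h1 : x < 1) :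
    0 < realValue F x := by
  refine (hF.summable_coeff_re h0 h1).tsum_pos
    (fun n => mul_nonneg (hF.coeff_re_nonneg n) (pow_nonneg h0 n)) 0 ?_
  rw [hF.coeff_zero]
  simp

theorem realValue_mono (hF : IsDilcherStolarsky F) {x y : ℝ} (h0 : 0 ≤ x) (hxy : x ≤ y)
    (h1 : y < 1) : realValue F x ≤ realValue F y := by
  refine (hF.summable_coeff_re h0 (hxy.trans_lt h1)).tsum_le_tsum (fun n => ?_)
    (hF.summable_coeff_re (h0.trans hxy) h1)
  exact mul_le_mul_of_nonneg_left (pow_le_pow_left₀ h0 hxy n) (hF.coeff_re_nonneg n)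

theorem realValue_eq (hF : IsDilcherStolarsky F) {x : ℝ} (h0 : 0 ≤ x) (h1 : x < 1) :
    realValue F x =
      (1 + x + x ^ 2) * realValue F (x ^ 4) - x ^ 4 * realValue F ((x ^ 4) ^ 4) := by
  have hx := ConvergesTo.X (x : ℂ)
  have h4 := hF.convergesTo (pow_nonneg h0 4) (pow_lt_one₀ h0 h1 four_ne_zero)
  have h16 := hF.convergesTo (pow_nonneg h0 16) (pow_lt_one₀ h0 h1 (by norm_num))
  rw [Complex.ofReal_pow] at h4 h16
  have h := ((hF.convergesTo h0 h1).sub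
    ((((ConvergesTo.one _).add hx).add (hx.pow 2)).mul (h4.expand 4 (by norm_num)))).add
    ((hx.pow 4).mul (h16.expand 16 (by norm_num)))
  rw [hF.2.2] at h
  have h' := h.unique (ConvergesTo.zero _)
  norm_cast at h'
  rw [← pow_mul]
  linear_combination h'

open Filter Topology Real in
-- Dividing the equation at `x_{n+2}` by `F(x_{n+1})` gives `r_{n+1} = A_n - x_{n+1} / r_n` with
-- `A_n → 3`; monotonicity of `F` supplies `r_n ≥ 1`.
theorem tendsto_ratio_realValue (hF : IsDilcherStolarsky F) : Tendsto
    (fun n => realValue F (radialPoint (n + 1)) / realValue F (radialPoint n)) atTop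
    (𝓝 (goldenRatio ^ 2)) := by
  have hx1 := tendsto_radialPoint.comp (tendsto_add_atTop_nat 1)
  have hx2 := tendsto_radialPoint.comp (tendsto_add_atTop_nat 2)
  have hpos : ∀ n, 0 < realValue F (radialPoint n) := fun n =>
    hF.realValue_pos (radialPoint_pos n).le (radialPoint_lt_one n)
  have hA : Tendsto (fun n => 1 + radialPoint (n + 2) + radialPoint (n + 2) ^ 2) atTop (𝓝 3) := by
    have h : Tendsto (fun n => 1 + radialPoint (n + 2) + radialPoint (n + 2) ^ 2) atTop
        (𝓝 (1 + 1 + 1 ^ 2)) := (hx2.const_add 1).add (hx2.pow 2)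
    rwa [show (1 : ℝ) + 1 + 1 ^ 2 = 3 by norm_num] at h
  refine tendsto_goldenRatio_sq_of_recurrence hA hx1 (fun n => ?_) fun n => ?_
  · rw [one_le_div (hpos n)]
    refine hF.realValue_mono (radialPoint_pos n).le ?_ (radialPoint_lt_one _)
    rw [← radialPoint_succ_pow_four n]
    exact pow_le_of_le_one (radialPoint_pos _).le (radialPoint_lt_one _).le four_ne_zero
  · have h := hF.realValue_eq (radialPoint_pos (n + 2)).le (radialPoint_lt_one _)
    rw [radialPoint_succ_pow_four (n + 1), radialPoint_succ_pow_four n] at h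
    have hn := (hpos n).ne'
    have hn1 := (hpos (n + 1)).ne'
    simp only [Function.comp_apply]
    rw [show n + 1 + 1 = n + 2 from rfl, h]
    field_simp

end IsDilcherStolarsky

/-! ### Algebraic independence -/

open Real in
theorem IsDilcherStolarsky.aeval_ne_zero {F : ℂ⟦X⟧} (hF : IsDilcherStolarsky F)
    {p : MvPolynomial (Fin 2) (Polynomial ℂ)} (hp : p ≠ 0) :
    MvPolynomial.aeval ![sternSeries, F] p ≠ 0 := by
  intro h0
  have hne : ∀ d ∈ p.support, p.coeff d ≠ 0 := fun d hd => MvPolynomial.mem_support_iff.1 hd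
  have hpos := fun n => sternValue_pos (radialPoint_pos n) (radialPoint_lt_one n)
  have hpos' := fun n => hF.realValue_pos (radialPoint_pos n).le (radialPoint_lt_one n)
  obtain ⟨n, hn⟩ := sum_ne_zero_of_ratio_tendsto (s := p.support)
    (Finset.nonempty_iff_ne_empty.2 fun h => hp (MvPolynomial.support_eq_empty.1 h))
    (t := fun d n => (p.coeff d).eval (radialPoint n : ℂ) *
      ((sternValue (radialPoint n) : ℂ) ^ d 0 * (realValue F (radialPoint n) : ℂ) ^ d 1))
    (l := fun d => (1 / 4) ^ (p.coeff d).rootMultiplicity 1 *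
      (9 ^ d 0 * (goldenRatio ^ 2) ^ d 1))
    (fun d _ => by positivity)
    (fun d _ d' _ h => by
      obtain ⟨e0, e1⟩ := four_pow_mul_nine_pow_mul_goldenRatio_pow_injective h
      ext i
      fin_cases i
      · exact e0
      · exact e1)
    (fun d hd => by
      filter_upwards [(tendsto_ratio_eval_radialPoint (hne d hd)).1] with n hn
      exact mul_ne_zero hn (mul_ne_zero
        (pow_ne_zero _ (Complex.ofReal_ne_zero.2 (hpos n).ne'))
        (pow_ne_zero _ (Complex.ofReal_ne_zero.2 (hpos' n).ne'))))
    (fun d hd => by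
      refine ((tendsto_ratio_eval_radialPoint (hne d hd)).2.mul
        ((tendsto_ratio_sternValue.pow (d 0)).mul (hF.tendsto_ratio_realValue.pow (d 1)))).congr
        fun n => ?_
      simp only [norm_mul, norm_pow, Complex.norm_real, Real.norm_of_nonneg (hpos _).le,
        Real.norm_of_nonneg (hpos' _).le, div_pow, div_mul_div_comm])
  -- The nonzero sum is the value at `x_n` of the series `p(S, F)`, which is assumed to be `0`.
  refine hn (ConvergesTo.unique (x := radialPoint n) (F := 0) ?_ (ConvergesTo.zero _))
  rw [← h0, MvPolynomial.aeval_def, MvPolynomial.eval₂_eq']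
  refine ConvergesTo.sum _ fun d _ => ?_
  rw [Fin.prod_univ_two]
  exact (ConvergesTo.coe_polynomial _ _).mul
    (((convergesTo_sternSeries (radialPoint_pos n).le (radialPoint_lt_one n)).pow _).mul
      ((hF.convergesTo (radialPoint_pos n).le (radialPoint_lt_one n)).pow _))

/-- Independence over `ℂ[z]` passes along the injection `ℂ⟦X⟧ → ℂ⸨X⸩`, then to `ℂ(z)`, which is
algebraic over `ℂ[z]`. -/
theorem IsDilcherStolarsky.algebraicIndependent {F : ℂ⟦X⟧} (hF : IsDilcherStolarsky F) :
    AlgebraicIndependent (RatFunc ℂ)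
      ![algebraMap ℂ⟦X⟧ ℂ⸨X⸩ sternSeries, algebraMap ℂ⟦X⟧ ℂ⸨X⸩ F] := by
  have hps : AlgebraicIndependent (Polynomial ℂ) ![sternSeries, F] :=
    algebraicIndependent_iff.2 fun p hp => by_contra fun h => hF.aeval_ne_zero h hp
  have : IsScalarTower (Polynomial ℂ) ℂ⟦X⟧ ℂ⸨X⸩ := IsScalarTower.of_algebraMap_eq fun _ => rfl
  have hls := hps.map' (f := IsScalarTower.toAlgHom (Polynomial ℂ) ℂ⟦X⟧ ℂ⸨X⸩)
    HahnSeries.ofPowerSeries_injective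
  have : Algebra.IsAlgebraic (Polynomial ℂ) (RatFunc ℂ) :=
    IsLocalization.isAlgebraic (RatFunc ℂ) (nonZeroDivisors (Polynomial ℂ))
  have h := hls.extendScalars (RatFunc ℂ)
  convert h using 1
  ext i : 1
  fin_cases i <;> rfl

universe u v w in
-- Viewed inside the field they generate, the `x i` still generate it, so it is algebraic over them
-- and they form a transcendence basis.
theorem AlgebraicIndependent.trdeg_intermediateField_adjoin
    {ι : Type u} {K : Type v} {L : Type w} [Field K] [Field L]
    [Algebra K L] {x : ι → L} (hx : AlgebraicIndependent K x) :
    Cardinal.lift.{u, w} (Algebra.trdeg K (IntermediateField.adjoin K (Set.range x))) =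
      Cardinal.lift.{w, u} (Cardinal.mk ι) := by
  set E := IntermediateField.adjoin K (Set.range x)
  let y : ι → E := fun i => ⟨x i, IntermediateField.subset_adjoin K _ ⟨i, rfl⟩⟩
  have hy : AlgebraicIndependent K y := AlgebraicIndependent.of_comp E.val hx
  have htop : IntermediateField.adjoin K (Set.range y) = ⊤ := by
    refine IntermediateField.lift_injective E ?_
    rw [IntermediateField.lift_adjoin, IntermediateField.lift_top, ← Set.range_comp]
    rfl
  have hb : IsTranscendenceBasis K y := by
    rw [hy.isTranscendenceBasis_iff_isAlgebraic]
    refine ⟨fun z => IntermediateField.isAlgebraic_adjoin_iff.1 ?_⟩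
    have hz : z ∈ IntermediateField.adjoin K (Set.range y) := htop ▸ IntermediateField.mem_top
    exact isAlgebraic_algebraMap (⟨z, hz⟩ : IntermediateField.adjoin K (Set.range y))
  exact hb.lift_cardinalMk_eq_trdeg.symm

theorem mainTheorem7 :
    (X * sternSeries - (1 + X + X ^ 2) * expand 2 (by norm_num) sternSeries = 0) ∧
    (∃! F : ℂ⟦X⟧, IsDilcherStolarsky F) ∧
    ∀ F : ℂ⟦X⟧, IsDilcherStolarsky F →
      AlgebraicIndependent (RatFunc ℂ)
        ![algebraMap ℂ⟦X⟧ ℂ⸨X⸩ sternSeries, algebraMap ℂ⟦X⟧ ℂ⸨X⸩ F] ∧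
      Algebra.trdeg (RatFunc ℂ)
        (IntermediateField.adjoin (RatFunc ℂ)
          {algebraMap ℂ⟦X⟧ ℂ⸨X⸩ sternSeries, algebraMap ℂ⟦X⟧ ℂ⸨X⸩ F}) = 2 := by
  refine ⟨sternSeries_functional_equation, existsUnique_isDilcherStolarsky, fun F hF => ?_⟩
  refine ⟨hF.algebraicIndependent, ?_⟩
  have h := hF.algebraicIndependent.trdeg_intermediateField_adjoin
  rw [Matrix.range_cons_cons_empty] at h
  simpa using h
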